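/- Consider a rigid body with principal moments of inertia $I_2 > I_1 > I_3 > 0$ and angular momentum $(l,0,0)$, $l>0$, in a space-fixed frame, with the rotor switched off. Its attitude is $R = R_1(\phi)R_2(\theta)R_3(\psi)$, where $R_i(\alpha)$ is the rotation by the angle $\alpha$ about the $i$th axis, and $\phi$, $\theta$, $\psi$ are differentiable functions of time $t\in\mathbb{R}$ (the somersault, tilt and twist angles). The motion satisfies $L = I\,\Omega$, where $L = R^{t}(l,0,0)^t$, $I=\mathrm{diag}(I_1,I_2,I_3)$, and the body angular velocity $\Omega$ is given by $\Omega\times v = R^{t}\dot R\,v$ for all $v \in \mathbb{R}^3$. Assume that the motion is twisting: $\theta$ attains a minimum $\theta_{\min}$ and a maximum $\theta_{\max}$ over all times, with $0<\theta_{\min}\le\theta_{\max}<\pi/2$. Put $s_-=\sin\theta_{\min}$, $s_+=\sin\theta_{\max}$, and $$\delta = \frac{I_1}{I_2}-1,\quad \gamma=\frac{I_1}{I_3}-1,\quad \nu=\frac{\delta}{\gamma},\quad k=\frac{s_+-s_-}{s_++s_-},\quad n_\pm = k\,\frac{1\pm s_-}{1\mp s_-}.$$ Let $$K(m)=\int_0^{\pi/2}\frac{dx}{\sqrt{1-m\sin^2x}},\qquad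 \Pi(n,m)=\int_0^{\pi/2}\frac{dx}{(1-n\sin^2x)\sqrt{1-m\sin^2x}}.$$ Then the body angular momentum $L(t)$ is periodic with a least positive period $P_3$, the twist angle $\psi$ advances by exactly $2\pi$ over any time interval of length $P_3$, and the change of somersault angle $\Phi_3=\phi(t+P_3)-\phi(t)$ does not depend on $t$. With the scaled period $\hat P_3 = l P_3/I_1$, $$\gamma\hat P_3 = \frac{8}{(s_++s_-)\sqrt{1-\nu}}\,K(k^2)$$ and $$\Phi_3-\hat P_3 = \frac{8\,s_-}{(s_++s_-)\sqrt{1-\nu}}\,\bigl(\Pi(n_-,k^2)-\Pi(n_+,k^2)\bigr).$$ -/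

import Mathlib

open Matrix

namespace TwistSomersault

noncomputable section

/-- Rotation by the angle `a` about the first axis. -/
def R₁ (a : ℝ) : Matrix (Fin 3) (Fin 3) ℝ :=
  !![1, 0, 0; 0, Real.cos a, -Real.sin a; 0, Real.sin a, Real.cos a]

/-- Rotation by the angle `a` about the second axis. -/
def R₂ (a : ℝ) : Matrix (Fin 3) (Fin 3) ℝ :=
  !![Real.cos a, 0, Real.sin a; 0, 1, 0; -Real.sin a, 0, Real.cos a]

/-- Rotation by the angle `a` about the third axis. -/
def R₃ (a : ℝ) : Matrix (Fin 3) (Fin 3) ℝ :=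
  !![Real.cos a, -Real.sin a, 0; Real.sin a, Real.cos a, 0; 0, 0, 1]

/-- The attitude matrix (body frame to space frame) with somersault angle `φ`, tilt angle `θ`
and twist angle `ψ`. -/
def attitude (φ θ ψ : ℝ → ℝ) (t : ℝ) : Matrix (Fin 3) (Fin 3) ℝ :=
  R₁ (φ t) * R₂ (θ t) * R₃ (ψ t)

/-- The entrywise time derivative of the attitude matrix. -/
def attitudeDeriv (φ θ ψ : ℝ → ℝ) (t : ℝ) : Matrix (Fin 3) (Fin 3) ℝ :=
  Matrix.of fun i j => deriv (fun s => attitude φ θ ψ s i j) t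

/-- The angular momentum `L = Rᵗ (l, 0, 0)` in the body frame; the angular momentum in the space
frame is the constant vector `(l, 0, 0)`. -/
def bodyAngularMomentum (l : ℝ) (φ θ ψ : ℝ → ℝ) (t : ℝ) : Fin 3 → ℝ :=
  (attitude φ θ ψ t)ᵀ *ᵥ ![l, 0, 0]

/-- `(φ, θ, ψ)` is a motion, in physical time `t`, of the rigid body with principal moments of
inertia `I₁, I₂, I₃` and a rotor with internal angular momentum `(0, h, 0)`, with angular
momentum `(l, 0, 0)` in the space frame: `L = I Ω + (0, h, 0)`, where the angular velocity `Ω` in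
the body frame is given by `Ω × v = Rᵗ R' v` for all `v`.  The rotor is off when `h = 0`. -/
structure IsMotion (I₁ I₂ I₃ l h : ℝ) (φ θ ψ : ℝ → ℝ) : Prop where
  differentiable_somersault : Differentiable ℝ φ
  differentiable_tilt : Differentiable ℝ θ
  differentiable_twist : Differentiable ℝ ψ
  equation : ∃ Ω : ℝ → Fin 3 → ℝ,
    (∀ t v, crossProduct (Ω t) v = ((attitude φ θ ψ t)ᵀ * attitudeDeriv φ θ ψ t) *ᵥ v) ∧
    ∀ t, bodyAngularMomentum l φ θ ψ t = Matrix.diagonal ![I₁, I₂, I₃] *ᵥ Ω t + ![0, h, 0]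

/-- `P` is the (minimal positive) period of the body angular momentum `L`. -/
def IsTwistPeriod (l : ℝ) (φ θ ψ : ℝ → ℝ) (P : ℝ) : Prop :=
  IsLeast {T : ℝ | 0 < T ∧ Function.Periodic (bodyAngularMomentum l φ θ ψ) T} P

/-- Legendre's complete elliptic integral of the first kind, as a function of the parameter
`m = k²`. -/
def ellipticK (m : ℝ) : ℝ :=
  ∫ x in (0 : ℝ)..(Real.pi / 2), 1 / Real.sqrt (1 - m * Real.sin x ^ 2)

/-- Legendre's complete elliptic integral of the third kind, with characteristic `n` and
parameter `m = k²`. -/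
def ellipticPi (n m : ℝ) : ℝ :=
  ∫ x in (0 : ℝ)..(Real.pi / 2),
    1 / ((1 - n * Real.sin x ^ 2) * Real.sqrt (1 - m * Real.sin x ^ 2))

end

end TwistSomersault

namespace TwistSomersault

/-! With ω = l/I₁, the equation of motion becomes φ' = ω(1 + δ sin²ψ), ψ' = ωγ sin θ (1 - ν sin²ψ),
plus an equation for θ' (`IsMotion.euler_angle_equations`). Conservation of energy amounts to cos²θ
(1 - ν sin²ψ) being constant. Since ν < 0, the tilt is least at ψ = 0 and greatest at ψ = π/2, which
fixes the constant and gives sin²θ (1 - ν sin²ψ) = s₋² - ν sin²ψ (`extremal_tilt`).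

Hence F(ψ) ψ' = γω with F(y) = 1/√((1 - ν sin²y)(s₋² - ν sin²y)), an autonomous equation for the
twist, and φ' - ω = ν sin²ψ F(ψ) ψ'. Over one turn of ψ, γ P̂₃ is the integral of F and Φ₃ - P̂₃
that of ν sin²y F(y), each four times its quarter-turn integral.

A Landen-type substitution (`integral_quarter_eq_integral_landen`) turns both factors under the root
into perfect squares over a common denominator, and the Jacobian then leaves Legendre integrals of
modulus k (`quarter_period_integrals`). -/

/-! ### Kinematics and the Euler angle equations -/

theorem attitude_eq (φ θ ψ : ℝ → ℝ) (t : ℝ) : attitude φ θ ψ t =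
    !![Real.cos (θ t) * Real.cos (ψ t), -(Real.cos (θ t) * Real.sin (ψ t)), Real.sin (θ t);
      Real.cos (φ t) * Real.sin (ψ t) + Real.sin (φ t) * (Real.sin (θ t) * Real.cos (ψ t)),
      Real.cos (φ t) * Real.cos (ψ t) - Real.sin (φ t) * (Real.sin (θ t) * Real.sin (ψ t)),
      -(Real.sin (φ t) * Real.cos (θ t));
      Real.sin (φ t) * Real.sin (ψ t) - Real.cos (φ t) * (Real.sin (θ t) * Real.cos (ψ t)),
      Real.sin (φ t) * Real.cos (ψ t) + Real.cos (φ t) * (Real.sin (θ t) * Real.sin (ψ t)),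
      Real.cos (φ t) * Real.cos (θ t)] := by
  ext i j
  fin_cases i <;> fin_cases j <;>
    simp [attitude, R₁, R₂, R₃, Matrix.mul_apply, Fin.sum_univ_three] <;> ring

theorem bodyAngularMomentum_eq (l : ℝ) (φ θ ψ : ℝ → ℝ) (t : ℝ) :
    bodyAngularMomentum l φ θ ψ t = ![l * (Real.cos (θ t) * Real.cos (ψ t)),
      -(l * (Real.cos (θ t) * Real.sin (ψ t))), l * Real.sin (θ t)] := by
  ext i
  rw [bodyAngularMomentum, attitude_eq]
  fin_cases i <;> simp [Matrix.mulVec, dotProduct, Fin.sum_univ_three] <;> ring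

/-- The entries of `Rᵗ R'` that carry the three components of the angular velocity. -/
theorem transpose_mul_attitudeDeriv {φ θ ψ : ℝ → ℝ} {t a b c : ℝ} (hφ : HasDerivAt φ a t)
    (hθ : HasDerivAt θ b t) (hψ : HasDerivAt ψ c t) :
    ((attitude φ θ ψ t)ᵀ * attitudeDeriv φ θ ψ t) 2 1 =
        a * (Real.cos (θ t) * Real.cos (ψ t)) + b * Real.sin (ψ t) ∧
    ((attitude φ θ ψ t)ᵀ * attitudeDeriv φ θ ψ t) 0 2 =
        -(a * (Real.cos (θ t) * Real.sin (ψ t))) + b * Real.cos (ψ t) ∧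
    ((attitude φ θ ψ t)ᵀ * attitudeDeriv φ θ ψ t) 1 0 = a * Real.sin (θ t) + c := by
  have h00 : attitudeDeriv φ θ ψ t 0 0 = _ :=
    (by simpa [attitude_eq] using hθ.cos.fun_mul hψ.cos :
      HasDerivAt (fun s => attitude φ θ ψ s 0 0) _ t).deriv
  have h01 : attitudeDeriv φ θ ψ t 0 1 = _ :=
    (by simpa [attitude_eq] using (hθ.cos.fun_mul hψ.sin).fun_neg :
      HasDerivAt (fun s => attitude φ θ ψ s 0 1) _ t).deriv
  have h02 : attitudeDeriv φ θ ψ t 0 2 = _ :=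
    (by simpa [attitude_eq] using hθ.sin :
      HasDerivAt (fun s => attitude φ θ ψ s 0 2) _ t).deriv
  have h10 : attitudeDeriv φ θ ψ t 1 0 = _ :=
    (by simpa [attitude_eq] using
        (hφ.cos.fun_mul hψ.sin).fun_add (hφ.sin.fun_mul (hθ.sin.fun_mul hψ.cos)) :
      HasDerivAt (fun s => attitude φ θ ψ s 1 0) _ t).deriv
  have h11 : attitudeDeriv φ θ ψ t 1 1 = _ :=
    (by simpa [attitude_eq] using
        (hφ.cos.fun_mul hψ.cos).fun_sub (hφ.sin.fun_mul (hθ.sin.fun_mul hψ.sin)) :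
      HasDerivAt (fun s => attitude φ θ ψ s 1 1) _ t).deriv
  have h12 : attitudeDeriv φ θ ψ t 1 2 = _ :=
    (by simpa [attitude_eq] using (hφ.sin.fun_mul hθ.cos).fun_neg :
      HasDerivAt (fun s => attitude φ θ ψ s 1 2) _ t).deriv
  have h20 : attitudeDeriv φ θ ψ t 2 0 = _ :=
    (by simpa [attitude_eq] using
        (hφ.sin.fun_mul hψ.sin).fun_sub (hφ.cos.fun_mul (hθ.sin.fun_mul hψ.cos)) :
      HasDerivAt (fun s => attitude φ θ ψ s 2 0) _ t).deriv
  have h21 : attitudeDeriv φ θ ψ t 2 1 = _ :=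
    (by simpa [attitude_eq] using
        (hφ.sin.fun_mul hψ.cos).fun_add (hφ.cos.fun_mul (hθ.sin.fun_mul hψ.sin)) :
      HasDerivAt (fun s => attitude φ θ ψ s 2 1) _ t).deriv
  have h22 : attitudeDeriv φ θ ψ t 2 2 = _ :=
    (by simpa [attitude_eq] using hφ.cos.fun_mul hθ.cos :
      HasDerivAt (fun s => attitude φ θ ψ s 2 2) _ t).deriv
  have e1 := Real.sin_sq_add_cos_sq (φ t)
  have e2 := Real.sin_sq_add_cos_sq (θ t)
  have e3 := Real.sin_sq_add_cos_sq (ψ t)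
  simp only [Matrix.mul_apply, Fin.sum_univ_three, Matrix.transpose_apply, h00, h01, h02, h10,
    h11, h12, h20, h21, h22]
  simp only [attitude_eq, Matrix.of_apply, Matrix.cons_val]
  generalize Real.sin (φ t) = x at *
  generalize Real.cos (φ t) = x' at *
  generalize Real.sin (θ t) = y at *
  generalize Real.cos (θ t) = y' at *
  generalize Real.sin (ψ t) = z at *
  generalize Real.cos (ψ t) = z' at *
  have f1 : x' ^ 2 = 1 - x ^ 2 := by linarith
  have f2 : y' ^ 2 = 1 - y ^ 2 := by linarith
  have f3 : z' ^ 2 = 1 - z ^ 2 := by linarith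
  refine ⟨?_, ?_, ?_⟩ <;> grind

/-- Testing Ω × v on basis vectors reads Ω off Rᵗ R'. The first two momentum equations are then
linear in φ', θ' with determinant proportional to cos θ, so gimbal lock must be excluded. -/
theorem IsMotion.euler_angle_equations {I₁ I₂ I₃ l : ℝ} {φ θ ψ : ℝ → ℝ}
    (hI₁ : I₁ ≠ 0) (hI₂ : I₂ ≠ 0) (hI₃ : I₃ ≠ 0) (h : IsMotion I₁ I₂ I₃ l 0 φ θ ψ)
    (hc : ∀ t, Real.cos (θ t) ≠ 0) (t : ℝ) :
    HasDerivAt φ (l / I₁ * (1 + (I₁ / I₂ - 1) * Real.sin (ψ t) ^ 2)) t ∧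
    HasDerivAt θ (-(l / I₁ * (I₁ / I₂ - 1) *
      (Real.cos (θ t) * Real.sin (ψ t) * Real.cos (ψ t)))) t ∧
    HasDerivAt ψ (l / I₁ * (Real.sin (θ t) *
      ((I₁ / I₃ - 1) - (I₁ / I₂ - 1) * Real.sin (ψ t) ^ 2))) t := by
  obtain ⟨Ω, hΩ, hL⟩ := h.equation
  have hφ := (h.differentiable_somersault t).hasDerivAt
  have hθ := (h.differentiable_tilt t).hasDerivAt
  have hψ := (h.differentiable_twist t).hasDerivAt
  obtain ⟨h1, h2, h3⟩ := transpose_mul_attitudeDeriv hφ hθ hψ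
  have g1 := congrFun (hΩ t (Pi.single 1 1)) 2
  have g2 := congrFun (hΩ t (Pi.single 2 1)) 0
  have g3 := congrFun (hΩ t (Pi.single 0 1)) 1
  rw [Matrix.mulVec_single_one, Matrix.col_apply] at g1 g2 g3
  rw [h1] at g1
  rw [h2] at g2
  rw [h3] at g3
  simp [cross_apply] at g1 g2 g3
  have k1 := congrFun (hL t) 0
  have k2 := congrFun (hL t) 1
  have k3 := congrFun (hL t) 2
  rw [bodyAngularMomentum_eq] at k1 k2 k3
  simp [Matrix.mulVec_diagonal] at k1 k2 k3
  rw [g1] at k1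
  rw [g2] at k2
  rw [g3] at k3
  have e3 := Real.sin_sq_add_cos_sq (ψ t)
  have hc := hc t
  generalize deriv φ t = a at *
  generalize deriv θ t = b at *
  generalize deriv ψ t = c at *
  generalize Real.sin (θ t) = y at *
  generalize Real.cos (θ t) = y' at *
  generalize Real.sin (ψ t) = z at *
  generalize Real.cos (ψ t) = z' at *
  have ha : a = l / I₁ * (1 + (I₁ / I₂ - 1) * z ^ 2) := by
    have : y' * (a * I₁ * I₂ - l * (I₂ + (I₁ - I₂) * z ^ 2)) = 0 := by
      linear_combination (-I₂ * z') * k1 + (z * I₁) * k2 + y' * (l * I₂ - a * I₁ * I₂) * e3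
    field_simp
    linarith [(mul_eq_zero.1 this).resolve_left hc]
  have hb : b = -(l / I₁ * (I₁ / I₂ - 1) * (y' * z * z')) := by
    field_simp
    linear_combination (-I₂ * z) * k1 + (-z' * I₁) * k2 - b * I₁ * I₂ * e3
  have hcc : c = l / I₁ * (y * ((I₁ / I₃ - 1) - (I₁ / I₂ - 1) * z ^ 2)) := by
    have : c = l * y / I₃ - a * y := by field_simp; linarith
    rw [this, ha]; field_simp; ring
  exact ⟨ha ▸ hφ, hb ▸ hθ, hcc ▸ hψ⟩

/-! ### The Landen-type substitution and quarter-turn symmetry -/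

open Real in
/-- The quadratic (Landen-type) substitution `sin y = A sin x / √((1 - n sin² x) (1 - n' sin² x))`
in an integral over a quarter turn, where `n n' = m` and `A² = (1 - n) (1 - n')`. -/
theorem integral_quarter_eq_integral_landen {A n n' m : ℝ} (hA : 0 < A) (hn : n < 1)
    (hn' : n' < 1) (hm : m < 1) (hnn : n * n' = m)
    (hA2 : A ^ 2 = (1 - n) * (1 - n')) {f F : ℝ → ℝ} (hF : Continuous F)
    (hf : ∀ y, F y = f (sin y ^ 2)) :
    ∫ y in (0 : ℝ)..(π / 2), F y = ∫ x in (0 : ℝ)..(π / 2),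
      f (A ^ 2 * sin x ^ 2 / ((1 - n * sin x ^ 2) * (1 - n' * sin x ^ 2))) *
        (A * (1 - m * sin x ^ 4) / ((1 - n * sin x ^ 2) * (1 - n' * sin x ^ 2) *
          √(1 - m * sin x ^ 2))) := by
  have pos : ∀ c : ℝ, c < 1 → ∀ x, 0 < 1 - c * sin x ^ 2 := fun c hc x => by
    rcases (sq_nonneg (sin x)).eq_or_lt with h | h
    · rw [← h]; norm_num
    · nlinarith [sin_sq_le_one x]
  set W : ℝ → ℝ := fun x => (1 - n * sin x ^ 2) * (1 - n' * sin x ^ 2) with hW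
  have hWp : ∀ x, 0 < W x := fun x => mul_pos (pos n hn x) (pos n' hn' x)
  have hWc : Continuous W := by fun_prop
  set s : ℝ → ℝ := fun x => A * sin x / √(W x) with hs
  have hsc : Continuous s := by
    refine Continuous.div (by fun_prop) (by fun_prop) fun x => (sqrt_pos.2 (hWp x)).ne'
  have hs2 : ∀ x, s x ^ 2 = A ^ 2 * sin x ^ 2 / W x := fun x => by
    simp only [hs]; rw [div_pow, sq_sqrt (hWp x).le, mul_pow]
  -- The conditions on `n * n'` and `A ^ 2` are what make this numerator factor.
  have hs1 : ∀ x, 1 - s x ^ 2 = cos x ^ 2 * (1 - m * sin x ^ 2) / W x := fun x => by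
    rw [hs2, eq_div_iff (hWp x).ne', sub_mul, div_mul_cancel₀ _ (hWp x).ne', hA2, cos_sq', ← hnn]
    simp only [hW]; ring
  have hsm : ∀ x, s x ^ 2 ≤ 1 := fun x => by
    have : 0 ≤ 1 - s x ^ 2 := by
      rw [hs1]; have := hWp x; have := pos m hm x; positivity
    linarith
  have hsinarc : ∀ x, sin (arcsin (s x)) = s x := fun x => by
    have := abs_le_one_iff_mul_self_le_one.2 (by simpa [sq] using hsm x)
    exact sin_arcsin (abs_le.1 this).1 (abs_le.1 this).2
  -- The derivative is needed only on the open interval: at π/2 the substitution reaches 1, where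
  -- `arcsin` is not differentiable.
  have key := intervalIntegral.integral_comp_mul_deriv'' (a := 0) (b := π / 2)
    (f := fun x => arcsin (s x))
    (f' := fun x => A * (1 - m * sin x ^ 4) / (W x * √(1 - m * sin x ^ 2))) (g := F)
    (continuous_arcsin.comp hsc).continuousOn ?_ ?_ hF.continuousOn
  · have h0 : arcsin (s 0) = 0 := by simp [hs]
    have h1 : arcsin (s (π / 2)) = π / 2 := by
      have : s (π / 2) = 1 := by
        simp only [hs, hW, sin_pi_div_two, one_pow, mul_one, ← hA2, sqrt_sq hA.le]
        exact div_self hA.ne'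
      rw [this, arcsin_one]
    simp only [h0, h1] at key
    rw [← key]
    refine intervalIntegral.integral_congr fun x _ => ?_
    simp only [Function.comp, hf, hsinarc, hs2, hW]
  · intro x hx
    rw [min_eq_left (by positivity), max_eq_right (by positivity)] at hx
    have hcos : 0 < cos x := cos_pos_of_mem_Ioo ⟨by linarith [hx.1, pi_pos], hx.2⟩
    have hmp := pos m hm x
    have hlt : s x ^ 2 < 1 := by
      have : 0 < 1 - s x ^ 2 := by
        rw [hs1]; have := hWp x; positivity
      linarith
    have habs := abs_lt.1 ((sq_lt_one_iff_abs_lt_one _).1 hlt)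
    have hd := (hasDerivAt_sin x)
    have hWd : HasDerivAt W ((-(n * (2 * sin x * cos x))) * (1 - n' * sin x ^ 2) +
        (1 - n * sin x ^ 2) * (-(n' * (2 * sin x * cos x)))) x := by
      have h2 : ∀ c : ℝ, HasDerivAt (fun x => 1 - c * sin x ^ 2)
          (-(c * (2 * sin x * cos x))) x := fun c => by
        simpa using ((hd.fun_pow 2).const_mul c).const_sub 1
      exact (h2 n).fun_mul (h2 n')
    have hsd := ((hd.const_mul A).fun_div (hWd.sqrt (hWp x).ne') (sqrt_pos.2 (hWp x)).ne')
    have hda := ((hasDerivAt_arcsin habs.1.ne' habs.2.ne).comp x hsd)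
    refine (hda.congr_deriv ?_).hasDerivWithinAt
    have hr : √(1 - s x ^ 2) = cos x * √(1 - m * sin x ^ 2) / √(W x) := by
      rw [hs1, sqrt_div (by positivity), sqrt_mul (by positivity), sqrt_sq hcos.le]
    rw [hr]
    have hq := sq_sqrt (hWp x).le
    have hq0 := sqrt_pos.2 (hWp x)
    have hr0 := sqrt_pos.2 hmp
    have hWe : W x = (1 - n * sin x ^ 2) * (1 - n' * sin x ^ 2) := rfl
    generalize √(1 - m * sin x ^ 2) = r at *
    generalize √(W x) = q at *
    rw [← hq] at hWe ⊢
    field_simp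
    rw [hWe, ← hnn]
    ring
  · refine Continuous.continuousOn (Continuous.div (by fun_prop) (by fun_prop) fun x => ?_)
    exact mul_ne_zero (hWp x).ne' (sqrt_pos.2 (pos m hm x)).ne'

open Real in
theorem integral_two_pi_eq_four_mul {f F : ℝ → ℝ} (hF : Continuous F)
    (hf : ∀ y, F y = f (sin y ^ 2)) :
    ∫ y in (0 : ℝ)..(2 * π), F y = 4 * ∫ y in (0 : ℝ)..(π / 2), F y := by
  have hi : ∀ a b, IntervalIntegrable F MeasureTheory.volume a b :=
    fun a b => hF.intervalIntegrable a b
  have h1 : ∫ y in (π / 2)..π, F y = ∫ y in (0 : ℝ)..(π / 2), F y := by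
    have := intervalIntegral.integral_comp_sub_left F (a := 0) (b := π / 2) π
    rw [sub_zero, sub_half] at this
    rw [← this]
    exact intervalIntegral.integral_congr fun x _ => by simp [hf]
  have h2 : ∫ y in π..(2 * π), F y = ∫ y in (0 : ℝ)..π, F y := by
    have := intervalIntegral.integral_comp_add_right F (a := 0) (b := π) π
    rw [zero_add, ← two_mul] at this
    rw [← this]
    exact intervalIntegral.integral_congr fun x _ => by simp [hf]
  rw [← intervalIntegral.integral_add_adjacent_intervals (hi 0 π) (hi π (2 * π)), h2,
    ← intervalIntegral.integral_add_adjacent_intervals (hi 0 (π / 2)) (hi (π / 2) π), h1]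
  ring

open Real

/-! ### Reduction to Legendre's elliptic integrals -/

section EllipticIntegrals

variable {p q ν : ℝ}

theorem continuous_slowness (hp : 0 < p) (hν : ν < 0) :
    Continuous fun y => 1 / √((1 - ν * sin y ^ 2) * (p ^ 2 - ν * sin y ^ 2)) := by
  refine Continuous.div (by fun_prop) (by fun_prop) fun y => (sqrt_pos.2 ?_).ne'
  have : 0 ≤ -ν * sin y ^ 2 := mul_nonneg (by linarith) (sq_nonneg _)
  exact mul_pos (by linarith) (by nlinarith)

/-- Here p, q play the roles of s₋, s₊. The last two identities say that, after the substitution, 1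
- ν sin²y and p² - ν sin²y have the numerators (1 - k sin²x)² and p²(1 + k sin²x)². -/
theorem landen_coefficients (hp : 0 < p) (hpq : p < q) (hq : q < 1)
    (hν : (1 - ν) * (1 - q ^ 2) = 1 - p ^ 2) {k n n' A : ℝ}
    (hk : k = (q - p) / (q + p)) (hn : n = k * ((1 - p) / (1 + p)))
    (hn' : n' = k * ((1 + p) / (1 - p))) (hA : A = 2 * p / ((q + p) * √(1 - ν))) :
    0 < A ∧ n < 1 ∧ n' < 1 ∧ k ^ 2 < 1 ∧ n * n' = k ^ 2 ∧ A ^ 2 = (1 - n) * (1 - n') ∧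
      ν * A ^ 2 = 2 * k - n - n' ∧ ν * A ^ 2 = -p ^ 2 * (2 * k + n + n') := by
  have hqp : 0 < q + p := by linarith
  have hp1 : 0 < 1 - p := by linarith
  have hp2 : 0 < 1 + p := by linarith
  have hq1 : 0 < 1 - q ^ 2 := by nlinarith
  have hν' : 1 - ν = (1 - p ^ 2) / (1 - q ^ 2) := by rw [eq_div_iff hq1.ne', hν]
  have hν0 : 0 < 1 - ν := by
    rw [hν']; exact div_pos (by nlinarith) hq1
  have hp3 : 0 < 1 - p ^ 2 := by nlinarith
  have hA2 : A ^ 2 = 4 * p ^ 2 * (1 - q ^ 2) / ((q + p) ^ 2 * (1 - p ^ 2)) := by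
    rw [hA, div_pow, mul_pow, mul_pow, sq_sqrt hν0.le, hν']
    field_simp
    norm_num
  have hk0 : 0 < k := by rw [hk]; exact div_pos (by linarith) hqp
  have hk1 : k < 1 := by rw [hk, div_lt_one hqp]; linarith
  have hνA : ν = 1 - (1 - p ^ 2) / (1 - q ^ 2) := by linarith
  have e : 1 - p ^ 2 = (1 - p) * (1 + p) := by ring
  refine ⟨?_, ?_, ?_, ?_, ?_, ?_, ?_, ?_⟩
  · rw [hA]; have := sqrt_pos.2 hν0; positivity
  · rw [hn]
    have : (1 - p) / (1 + p) < 1 := by rw [div_lt_one hp2]; linarith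
    have : 0 < (1 - p) / (1 + p) := by positivity
    nlinarith
  · rw [hn', hk, div_mul_div_comm, div_lt_one (by positivity)]
    nlinarith
  · nlinarith
  · rw [hn, hn']; field_simp
  · rw [hA2, hn, hn', hk, e]; field_simp; ring
  · rw [hA2, hνA, hn, hn', hk, e]
    field_simp; ring
  · rw [hA2, hνA, hn, hn', hk, e]
    field_simp; ring

/-- The quarter period of the twist in terms of Legendre's integral of the first kind, and the
corresponding advance of the somersault angle in terms of the integral of the third kind. -/
theorem quarter_period_integrals (hp : 0 < p) (hpq : p < q) (hq : q < 1)
    (hν0 : ν < 0) (hν : (1 - ν) * (1 - q ^ 2) = 1 - p ^ 2) {k n n' : ℝ}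
    (hk : k = (q - p) / (q + p)) (hn : n = k * ((1 - p) / (1 + p)))
    (hn' : n' = k * ((1 + p) / (1 - p))) :
    ∫ y in (0 : ℝ)..(π / 2), 1 / √((1 - ν * sin y ^ 2) * (p ^ 2 - ν * sin y ^ 2)) =
        2 / ((q + p) * √(1 - ν)) * ellipticK (k ^ 2) ∧
    ∫ y in (0 : ℝ)..(π / 2),
        ν * sin y ^ 2 * (1 / √((1 - ν * sin y ^ 2) * (p ^ 2 - ν * sin y ^ 2))) =
        2 * p / ((q + p) * √(1 - ν)) * (ellipticPi n (k ^ 2) - ellipticPi n' (k ^ 2)) := by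
  obtain ⟨A, hAdef⟩ : ∃ A, A = 2 * p / ((q + p) * √(1 - ν)) := ⟨_, rfl⟩
  obtain ⟨hA, hn1, hn1', hk1, hnn, hA2, hνA, hνA'⟩ :=
    landen_coefficients hp hpq hq hν hk hn hn' hAdef
  have hk0 : 0 < k := by rw [hk]; exact div_pos (by linarith) (by linarith)
  have hklt : k < 1 := by nlinarith
  have hA' : 2 / ((q + p) * √(1 - ν)) = A / p := by rw [hAdef]; field_simp
  have pos : ∀ c : ℝ, c < 1 → ∀ x, 0 < 1 - c * sin x ^ 2 := fun c hc x => by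
    rcases (sq_nonneg (sin x)).eq_or_lt with h | h
    · rw [← h]; norm_num
    · nlinarith [sin_sq_le_one x]
  have hcont := continuous_slowness hp hν0
  have hf : ∀ x, 1 / √((1 - ν * (A ^ 2 * sin x ^ 2 / ((1 - n * sin x ^ 2) *
        (1 - n' * sin x ^ 2)))) * (p ^ 2 - ν * (A ^ 2 * sin x ^ 2 / ((1 - n * sin x ^ 2) *
        (1 - n' * sin x ^ 2))))) * (A * (1 - k ^ 2 * sin x ^ 4) / ((1 - n * sin x ^ 2) *
        (1 - n' * sin x ^ 2) * √(1 - k ^ 2 * sin x ^ 2))) =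
        A / p * (1 / √(1 - k ^ 2 * sin x ^ 2)) := fun x => by
    have hWp : 0 < (1 - n * sin x ^ 2) * (1 - n' * sin x ^ 2) :=
      mul_pos (pos n hn1 x) (pos n' hn1' x)
    have hr := sqrt_pos.2 (pos _ hk1 x)
    have hks := pos k hklt x
    have hks' : 0 < 1 + k * sin x ^ 2 := by positivity
    have e1 : 1 - ν * (A ^ 2 * sin x ^ 2 / ((1 - n * sin x ^ 2) * (1 - n' * sin x ^ 2))) =
        (1 - k * sin x ^ 2) ^ 2 / ((1 - n * sin x ^ 2) * (1 - n' * sin x ^ 2)) := by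
      rw [eq_div_iff hWp.ne', sub_mul, mul_assoc ν, div_mul_cancel₀ _ hWp.ne']
      linear_combination (-sin x ^ 2) * hνA + sin x ^ 4 * hnn
    have e2 : p ^ 2 - ν * (A ^ 2 * sin x ^ 2 / ((1 - n * sin x ^ 2) * (1 - n' * sin x ^ 2))) =
        (p * (1 + k * sin x ^ 2)) ^ 2 / ((1 - n * sin x ^ 2) * (1 - n' * sin x ^ 2)) := by
      rw [eq_div_iff hWp.ne', sub_mul, mul_assoc ν, div_mul_cancel₀ _ hWp.ne']
      linear_combination (-sin x ^ 2) * hνA' + p ^ 2 * sin x ^ 4 * hnn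
    have e3 : ∀ a b w : ℝ, 0 < a → 0 < b → 0 < w → √(a ^ 2 / w * (b ^ 2 / w)) = a * b / w :=
      fun a b w ha hb hw => by
        rw [div_mul_div_comm, ← mul_pow, ← sq, ← div_pow, sqrt_sq (by positivity)]
    rw [e1, e2, e3 _ _ _ hks (mul_pos hp hks') hWp]
    generalize √(1 - k ^ 2 * sin x ^ 2) = r at *
    generalize (1 - n * sin x ^ 2) * (1 - n' * sin x ^ 2) = w at *
    field_simp
    ring
  constructor
  · rw [integral_quarter_eq_integral_landen hA hn1 hn1' hk1 hnn hA2
      (f := fun z => 1 / √((1 - ν * z) * (p ^ 2 - ν * z))) hcont fun y => rfl, ellipticK, hA',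
      ← intervalIntegral.integral_const_mul]
    exact intervalIntegral.integral_congr fun x _ => hf x
  · have hPi : ∀ c < 1, IntervalIntegrable
        (fun x => 1 / ((1 - c * sin x ^ 2) * √(1 - k ^ 2 * sin x ^ 2)))
        MeasureTheory.volume 0 (π / 2) := fun c hc => by
      refine (Continuous.div (by fun_prop) (by fun_prop) fun x => ?_).intervalIntegrable _ _
      exact mul_ne_zero (pos c hc x).ne' (sqrt_pos.2 (pos _ hk1 x)).ne'
    rw [integral_quarter_eq_integral_landen hA hn1 hn1' hk1 hnn hA2
      (f := fun z => ν * z * (1 / √((1 - ν * z) * (p ^ 2 - ν * z)))) (by fun_prop) fun y => rfl,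
      ellipticPi, ellipticPi, ← hAdef, ← intervalIntegral.integral_sub (hPi n hn1) (hPi n' hn1'),
      ← intervalIntegral.integral_const_mul]
    refine intervalIntegral.integral_congr fun x _ => ?_
    rw [mul_assoc, hf x]
    have h1 := pos n hn1 x
    have h2 := pos n' hn1' x
    have hr := sqrt_pos.2 (pos _ hk1 x)
    -- This is the partial fraction coefficient: 1/u - 1/v = (n - n') z/(u v).
    have hd : ν * A ^ 2 = p * (n - n') := by
      rw [hνA, hn, hn']
      have : 0 < 1 - p := by linarith
      have : 0 < 1 + p := by linarith
      field_simp; ring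
    generalize √(1 - k ^ 2 * sin x ^ 2) = r at *
    generalize sin x ^ 2 = z at *
    generalize hu : 1 - n * z = u at *
    generalize hv : 1 - n' * z = v at *
    field_simp
    rw [hd, ← hu, ← hv]
    ring

end EllipticIntegrals

/-! ### Autonomous equations with periodic coefficients -/

section PeriodicFlow

variable {F ψ : ℝ → ℝ}

theorem hasDerivAt_integral_comp {G : ℝ → ℝ} (hG : Continuous G) {d t : ℝ}
    (hψ : HasDerivAt ψ d t) :
    HasDerivAt (fun s => ∫ y in (0 : ℝ)..(ψ s), G y) (G (ψ t) * d) t :=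
  (hG.integral_hasStrictDerivAt 0 (ψ t)).hasDerivAt.comp t hψ

theorem integral_add_period {G : ℝ → ℝ} (hG : Continuous G) {T : ℝ}
    (hper : Function.Periodic G T) (y : ℝ) :
    ∫ x in (0 : ℝ)..(y + T), G x = (∫ x in (0 : ℝ)..y, G x) + ∫ x in (0 : ℝ)..T, G x := by
  rw [← intervalIntegral.integral_add_adjacent_intervals (hG.intervalIntegrable 0 y)
    (hG.intervalIntegrable y (y + T)), hper.intervalIntegral_add_eq y 0, zero_add]

/-- A solution of `F(ψ) ψ' = c` with `F` positive and `T`-periodic advances by `T` during the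
time `c⁻¹ ∫₀ᵀ F`. -/
theorem add_time_eq_add_period (hF : Continuous F) (hpos : ∀ y, 0 < F y) {T c : ℝ} (hc : 0 < c)
    (hper : Function.Periodic F T) {ψ' : ℝ → ℝ} (hψ : ∀ t, HasDerivAt ψ (ψ' t) t)
    (hode : ∀ t, F (ψ t) * ψ' t = c) (t : ℝ) :
    ψ (t + (∫ y in (0 : ℝ)..T, F y) / c) = ψ t + T := by
  have hmono : StrictMono fun y => ∫ x in (0 : ℝ)..y, F x :=
    strictMono_of_hasDerivAt_pos (fun y => (hF.integral_hasStrictDerivAt 0 y).hasDerivAt) hpos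
  -- Separation of variables: the primitive of `F` along ψ is linear in time.
  have hd : ∀ s, HasDerivAt (fun s => (∫ y in (0 : ℝ)..(ψ s), F y) - c * s) 0 s := fun s => by
    refine ((hasDerivAt_integral_comp hF (hψ s)).fun_sub
      ((hasDerivAt_id s).const_mul c)).congr_deriv ?_
    rw [hode, mul_one, sub_self]
  have := is_const_of_deriv_eq_zero (fun s => (hd s).differentiableAt) (fun s => (hd s).deriv)
    (t + (∫ y in (0 : ℝ)..T, F y) / c) t
  apply hmono.injective
  simp only [integral_add_period hF hper]
  simp only [mul_add, mul_div_cancel₀ _ hc.ne'] at this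
  linarith

/-- φ - a t minus the primitive of `G` at ψ is constant. This yields the somersault advance,
independent of the starting time. -/
theorem sub_eq_of_hasDerivAt_add_mul {G φ : ℝ → ℝ} (hG : Continuous G) {T a P : ℝ}
    (hper : Function.Periodic G T) {ψ' : ℝ → ℝ} (hψ : ∀ t, HasDerivAt ψ (ψ' t) t)
    (hφ : ∀ t, HasDerivAt φ (a + G (ψ t) * ψ' t) t) {t : ℝ} (hP : ψ (t + P) = ψ t + T) :
    φ (t + P) - φ t = a * P + ∫ y in (0 : ℝ)..T, G y := by
  have hd : ∀ s, HasDerivAt (fun s => φ s - a * s - ∫ y in (0 : ℝ)..(ψ s), G y) 0 s := fun s => by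
    refine (((hφ s).fun_sub ((hasDerivAt_id s).const_mul a)).fun_sub
      (hasDerivAt_integral_comp hG (hψ s))).congr_deriv ?_
    ring
  have := is_const_of_deriv_eq_zero (fun s => (hd s).differentiableAt) (fun s => (hd s).deriv)
    (t + P) t
  simp only [hP, integral_add_period hG hper] at this
  linarith

end PeriodicFlow

/-! ### Energy, tilt extrema and minimality of the period -/

/-- Ensures that the twist actually attains 0 and π/2, where the tilt is extremal. -/
theorem surjective_of_le_deriv {f : ℝ → ℝ} (hf : Differentiable ℝ f) {c : ℝ} (hc : 0 < c)
    (h : ∀ t, c ≤ deriv f t) : Function.Surjective f := by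
  have hle := mul_sub_le_image_sub_of_le_deriv hf h
  refine hf.continuous.surjective ?_ ?_
  · refine Filter.tendsto_atTop_mono' _ ?_ (Filter.tendsto_atTop_add_const_right _ (f 0)
      (Filter.tendsto_id.const_mul_atTop hc))
    filter_upwards [Filter.eventually_ge_atTop 0] with t ht
    have := hle ht
    simp only [id]; linarith
  · refine Filter.tendsto_atBot_mono' _ ?_ (Filter.tendsto_atBot_add_const_right _ (f 0)
      (Filter.tendsto_id.const_mul_atBot hc))
    filter_upwards [Filter.eventually_le_atBot 0] with t ht
    have := hle ht
    simp only [id]; linarith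

/-- Conservation of energy for the Euler angles of the torque-free rigid body. -/
theorem energy_conserved {ω δ γ ν : ℝ} (hνγ : ν * γ = δ) {θ ψ : ℝ → ℝ}
    (hθ : ∀ t, HasDerivAt θ (-(ω * δ * (cos (θ t) * sin (ψ t) * cos (ψ t)))) t)
    (hψ : ∀ t, HasDerivAt ψ (ω * (sin (θ t) * (γ - δ * sin (ψ t) ^ 2))) t) (t s : ℝ) :
    sin (θ t) ^ 2 * (1 - ν * sin (ψ t) ^ 2) + ν * sin (ψ t) ^ 2 =
      sin (θ s) ^ 2 * (1 - ν * sin (ψ s) ^ 2) + ν * sin (ψ s) ^ 2 := by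
  have hd : ∀ s, HasDerivAt (fun t => sin (θ t) ^ 2 * (1 - ν * sin (ψ t) ^ 2) +
      ν * sin (ψ t) ^ 2) 0 s := fun s => by
    have h1 := ((hψ s).sin.fun_pow 2).const_mul ν
    refine ((((hθ s).sin.fun_pow 2).fun_mul (h1.const_sub 1)).fun_add h1).congr_deriv ?_
    have := cos_sq' (θ s)
    rw [← hνγ]
    generalize cos (θ s) = c at *
    simp only [Nat.cast_ofNat, Nat.add_one_sub_one, pow_one]
    linear_combination (-2 * ν * γ * ω * sin (θ s) * sin (ψ s) * cos (ψ s) *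
      (1 - ν * sin (ψ s) ^ 2)) * this
  exact is_const_of_deriv_eq_zero (fun s => (hd s).differentiableAt) (fun s => (hd s).deriv) t s

/-- In a twisting motion the tilt is extremal when the twist angle is `0` and `π / 2`. -/
theorem extremal_tilt {ν : ℝ} (hν : ν < 0) {θ ψ : ℝ → ℝ} {θmin θmax : ℝ}
    (hmin : IsLeast (Set.range θ) θmin) (hmax : IsGreatest (Set.range θ) θmax)
    (hθmin : 0 < θmin) (hθmax : θmax < π / 2)
    (hE : ∀ t s, sin (θ t) ^ 2 * (1 - ν * sin (ψ t) ^ 2) + ν * sin (ψ t) ^ 2 =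
      sin (θ s) ^ 2 * (1 - ν * sin (ψ s) ^ 2) + ν * sin (ψ s) ^ 2)
    (hsurj : Function.Surjective ψ) :
    (∀ t, sin (θ t) ^ 2 * (1 - ν * sin (ψ t) ^ 2) = sin θmin ^ 2 - ν * sin (ψ t) ^ 2) ∧
      (1 - ν) * (1 - sin θmax ^ 2) = 1 - sin θmin ^ 2 := by
  have hlo : ∀ t, θmin ≤ θ t := fun t => hmin.2 ⟨t, rfl⟩
  have hhi : ∀ t, θ t ≤ θmax := fun t => hmax.2 ⟨t, rfl⟩
  have hmono : ∀ t s, θ t ≤ θ s → sin (θ t) ≤ sin (θ s) := fun t s h =>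
    sin_le_sin_of_le_of_le_pi_div_two (by linarith [hlo t, pi_pos]) (by linarith [hhi s]) h
  have hpos : ∀ t, 0 < sin (θ t) := fun t =>
    sin_pos_of_pos_of_lt_pi (by linarith [hlo t]) (by linarith [hhi t, pi_pos])
  obtain ⟨t₀, h₀⟩ := hsurj 0
  obtain ⟨t₁, h₁⟩ := hsurj (π / 2)
  obtain ⟨a, ha⟩ := hmin.1
  obtain ⟨b, hb⟩ := hmax.1
  have hmin' : sin θmin ^ 2 = sin (θ t₀) ^ 2 := by
    rw [← ha]
    refine le_antisymm (pow_le_pow_left₀ (hpos a).le (hmono _ _ (ha ▸ hlo t₀)) 2) ?_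
    have := hE a t₀
    rw [h₀, sin_zero] at this
    nlinarith [mul_nonneg (neg_nonneg.2 hν.le) (sq_nonneg (sin (ψ a))), sin_sq_le_one (θ a),
      mul_nonneg (mul_nonneg (neg_nonneg.2 hν.le) (sq_nonneg (sin (ψ a))))
        (sub_nonneg.2 (sin_sq_le_one (θ a)))]
  have hmax' : sin θmax ^ 2 = sin (θ t₁) ^ 2 := by
    rw [← hb]
    refine le_antisymm ?_ (pow_le_pow_left₀ (hpos t₁).le (hmono _ _ (hb ▸ hhi t₁)) 2)
    have := hE b t₁
    rw [h₁, sin_pi_div_two] at this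
    nlinarith [mul_nonneg (mul_nonneg (neg_nonneg.2 hν.le) (sub_nonneg.2 (sin_sq_le_one (ψ b))))
        (sub_nonneg.2 (sin_sq_le_one (θ b)))]
  constructor
  · intro t
    have := hE t t₀
    rw [h₀, sin_zero] at this
    rw [hmin']
    linarith
  · have := hE t₁ t₀
    rw [h₀, h₁, sin_zero, sin_pi_div_two] at this
    rw [hmin', hmax']
    linarith

/-- If the twist angle increases strictly and advances by a full turn in time `P`, the tilt being
determined by the twist, then `P` is the least period of the body angular momentum. -/
theorem isTwistPeriod_of_add_two_pi {l P : ℝ} (hl : 0 < l) {φ θ ψ : ℝ → ℝ}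
    (hmono : StrictMono ψ) (hP : 0 < P)
    (hcos : ∀ t, 0 < cos (θ t)) (hψP : ∀ t, ψ (t + P) = ψ t + 2 * π)
    (hθP : ∀ t, θ (t + P) = θ t) : IsTwistPeriod l φ θ ψ P := by
  constructor
  · refine ⟨hP, fun t => ?_⟩
    simp [bodyAngularMomentum_eq, hψP, hθP]
  · rintro T ⟨hT, hper⟩
    have h := hper 0
    simp only [bodyAngularMomentum_eq, zero_add] at h
    have h0 := congrFun h 0
    have h1 := congrFun h 1
    simp [hl.ne'] at h0 h1
    have e1 := sin_sq_add_cos_sq (ψ T)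
    have e0 := sin_sq_add_cos_sq (ψ 0)
    -- The first two components of L have Euclidean norm l cos θ, and cos θ is positive.
    have hcc : cos (θ T) = cos (θ 0) := by
      rw [← sq_eq_sq₀ (hcos T).le (hcos 0).le]
      linear_combination (cos (θ T) * cos (ψ T) + cos (θ 0) * cos (ψ 0)) * h0 +
        (cos (θ T) * sin (ψ T) + cos (θ 0) * sin (ψ 0)) * h1 - cos (θ T) ^ 2 * e1 +
        cos (θ 0) ^ 2 * e0
    rw [hcc] at h0 h1
    have hc := mul_left_cancel₀ (hcos 0).ne' h0
    have hs := mul_left_cancel₀ (hcos 0).ne' h1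
    obtain ⟨n, hn⟩ := Real.Angle.angle_eq_iff_two_pi_dvd_sub.1
      (Real.Angle.cos_sin_inj hc hs)
    have hlt := hmono hT
    have hn1 : 0 < n := by
      by_contra hcon
      have : (n : ℝ) ≤ 0 := by exact_mod_cast not_lt.1 hcon
      nlinarith [pi_pos]
    have hn2 : (1 : ℝ) ≤ n := by exact_mod_cast hn1
    rw [← hmono.le_iff_le]
    have := hψP 0
    rw [zero_add] at this
    nlinarith [pi_pos]

end TwistSomersault

/-! ### Assembly -/

open Real TwistSomersault in
theorem mainTheorem8 (I₁ I₂ I₃ l : ℝ) (hI₃ : 0 < I₃) (hI₃₁ : I₃ < I₁) (hI₁₂ : I₁ < I₂)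
    (hl : 0 < l) (φ θ ψ : ℝ → ℝ) (hmotion : TwistSomersault.IsMotion I₁ I₂ I₃ l 0 φ θ ψ)
    (θmin θmax : ℝ) (hmin : IsLeast (Set.range θ) θmin) (hmax : IsGreatest (Set.range θ) θmax)
    (hθmin : 0 < θmin) (hθmax : θmax < Real.pi / 2)
    (δ γ ν sm sp k nm np : ℝ)
    (hδ : δ = I₁ / I₂ - 1) (hγ : γ = I₁ / I₃ - 1) (hν : ν = δ / γ)
    (hsm : sm = Real.sin θmin) (hsp : sp = Real.sin θmax)
    (hk : k = (sp - sm) / (sp + sm))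
    (hnm : nm = k * ((1 - sm) / (1 + sm))) (hnp : np = k * ((1 + sm) / (1 - sm))) :
    ∃ P Phat Φ : ℝ, TwistSomersault.IsTwistPeriod l φ θ ψ P ∧
      (∀ t, ψ (t + P) - ψ t = 2 * Real.pi) ∧
      Phat = l / I₁ * P ∧
      (∀ t, φ (t + P) - φ t = Φ) ∧
      γ * Phat = 8 / ((sp + sm) * Real.sqrt (1 - ν)) * TwistSomersault.ellipticK (k ^ 2) ∧
      Φ - Phat = 8 * sm / ((sp + sm) * Real.sqrt (1 - ν)) *
        (TwistSomersault.ellipticPi nm (k ^ 2) - TwistSomersault.ellipticPi np (k ^ 2)) := by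
  have hI₁ : 0 < I₁ := hI₃.trans hI₃₁
  have hI₂ : 0 < I₂ := hI₁.trans hI₁₂
  have hγ0 : 0 < γ := by rw [hγ, sub_pos, one_lt_div hI₃]; exact hI₃₁
  have hδ0 : δ < 0 := by rw [hδ, sub_neg, div_lt_one hI₂]; exact hI₁₂
  have hν0 : ν < 0 := by rw [hν]; exact div_neg_of_neg_of_pos hδ0 hγ0
  have hνγ : ν * γ = δ := by rw [hν, div_mul_cancel₀ _ hγ0.ne']
  have hlo : ∀ t, θmin ≤ θ t := fun t => hmin.2 ⟨t, rfl⟩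
  have hhi : ∀ t, θ t ≤ θmax := fun t => hmax.2 ⟨t, rfl⟩
  have hminmax : θmin ≤ θmax := (hlo 0).trans (hhi 0)
  have hcos : ∀ t, 0 < cos (θ t) := fun t =>
    cos_pos_of_mem_Ioo ⟨by linarith [hlo t, pi_pos], by linarith [hhi t]⟩
  have hsm0 : 0 < sm := hsm ▸ sin_pos_of_pos_of_lt_pi hθmin (by linarith [pi_pos])
  have hsin : ∀ t, sm ≤ sin (θ t) := fun t => hsm ▸
    sin_le_sin_of_le_of_le_pi_div_two (by linarith [pi_pos]) (by linarith [hhi t]) (hlo t)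
  have heuler := hmotion.euler_angle_equations hI₁.ne' hI₂.ne' hI₃.ne' fun t => (hcos t).ne'
  rw [← hδ, ← hγ] at heuler
  have hψ := fun t => (heuler t).2.2
  have hge : ∀ t, l / I₁ * (sm * γ) ≤ l / I₁ * (sin (θ t) * (γ - δ * sin (ψ t) ^ 2)) := fun t => by
    have : 0 ≤ -δ * sin (ψ t) ^ 2 := mul_nonneg (by linarith) (sq_nonneg _)
    gcongr
    · exact hsm0.le.trans (hsin t)
    · exact hsin t
    · linarith
  have hc0 : 0 < l / I₁ * (sm * γ) := by positivity
  have hmono : StrictMono ψ := strictMono_of_hasDerivAt_pos hψ fun t => hc0.trans_le (hge t)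
  have hsurj : Function.Surjective ψ := surjective_of_le_deriv hmotion.differentiable_twist hc0
    fun t => (hψ t).deriv ▸ hge t
  obtain ⟨hE, hend⟩ := extremal_tilt hν0 hmin hmax hθmin hθmax
    (energy_conserved hνγ (fun t => (heuler t).2.1) hψ) hsurj
  rw [← hsm] at hE hend
  rw [← hsp] at hend
  have hsp1 : sp < 1 := by
    rw [hsp, ← sin_pi_div_two]
    exact sin_lt_sin_of_lt_of_le_pi_div_two (by linarith [pi_pos]) le_rfl hθmax
  have hsmp : sm < sp := by
    have : sm ≤ sp := by
      rw [hsm, hsp]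
      exact sin_le_sin_of_le_of_le_pi_div_two (by linarith [pi_pos]) hθmax.le hminmax
    -- Equal extrema would force ν = 0 in `hend`.
    refine this.lt_of_ne fun h => ?_
    rw [h] at hend
    have : 0 < 1 - sp ^ 2 := by nlinarith
    nlinarith [mul_pos (neg_pos.2 hν0) this]
  obtain ⟨hK, hPi⟩ := quarter_period_integrals hsm0 hsmp hsp1 hν0 hend hk hnm hnp
  have hFc := continuous_slowness hsm0 hν0
  obtain ⟨F, hF⟩ : ∃ F : ℝ → ℝ,
      F = fun y => 1 / √((1 - ν * sin y ^ 2) * (sm ^ 2 - ν * sin y ^ 2)) := ⟨_, rfl⟩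
  have hFpos : ∀ y, 0 < F y := fun y => by
    have : 0 ≤ -ν * sin y ^ 2 := mul_nonneg (by linarith) (sq_nonneg _)
    rw [hF]
    exact one_div_pos.2 (sqrt_pos.2 (mul_pos (by linarith) (by nlinarith)))
  have hFψ : ∀ t, F (ψ t) * (sin (θ t) * (1 - ν * sin (ψ t) ^ 2)) = 1 := fun t => by
    have h0 : 0 < sin (θ t) := hsm0.trans_le (hsin t)
    have h1 : 0 ≤ -ν * sin (ψ t) ^ 2 := mul_nonneg (by linarith) (sq_nonneg _)
    have h2 : 0 < 1 - ν * sin (ψ t) ^ 2 := by linarith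
    simp only [hF]
    rw [← hE, show (1 - ν * sin (ψ t) ^ 2) * (sin (θ t) ^ 2 * (1 - ν * sin (ψ t) ^ 2)) =
      (sin (θ t) * (1 - ν * sin (ψ t) ^ 2)) ^ 2 by ring, sqrt_sq (by positivity)]
    exact one_div_mul_cancel (by positivity)
  have hGc : Continuous fun y => ν * sin y ^ 2 * F y := by rw [hF]; fun_prop
  have hI := integral_two_pi_eq_four_mul (hF ▸ hFc) (F := F)
    (f := fun z => 1 / √((1 - ν * z) * (sm ^ 2 - ν * z))) fun y => by rw [hF]
  have hJ := integral_two_pi_eq_four_mul hGc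
    (f := fun z => ν * z * (1 / √((1 - ν * z) * (sm ^ 2 - ν * z)))) fun y => by rw [hF]
  simp only [← hF] at hFc
  have hc : 0 < γ * (l / I₁) := by positivity
  have hψP := add_time_eq_add_period hFc hFpos (T := 2 * π) hc (fun y => by simp [hF]) hψ
    fun t => by rw [← hνγ]; linear_combination γ * (l / I₁) * hFψ t
  obtain ⟨P, hP⟩ : ∃ P, P = (∫ y in (0 : ℝ)..(2 * π), F y) / (γ * (l / I₁)) := ⟨_, rfl⟩
  rw [← hP] at hψP
  have hP0 : 0 < P := by
    rw [hP]
    refine div_pos (intervalIntegral.intervalIntegral_pos_of_pos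
      (hFc.intervalIntegrable _ _) hFpos (by positivity)) hc
  -- The energy relation determines sin²θ from ψ, and θ stays where sine is positive and injective.
  have hθP : ∀ t, θ (t + P) = θ t := fun t => by
    have h1 := hE (t + P)
    rw [hψP, sin_add_two_pi, ← hE t] at h1
    have h2 : 0 ≤ -ν * sin (ψ t) ^ 2 := mul_nonneg (by linarith) (sq_nonneg _)
    have h3 := (sq_eq_sq₀ (hsm0.le.trans (hsin _)) (hsm0.le.trans (hsin _))).1
      (mul_right_cancel₀ (by linarith : 1 - ν * sin (ψ t) ^ 2 ≠ 0) h1)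
    exact injOn_sin ⟨by linarith [hlo (t + P), pi_pos], by linarith [hhi (t + P)]⟩
      ⟨by linarith [hlo t, pi_pos], by linarith [hhi t]⟩ h3
  have hφP := fun t => sub_eq_of_hasDerivAt_add_mul hGc (T := 2 * π) (a := l / I₁)
    (fun y => by simp [hF]) hψ (φ := φ) (fun t => (heuler t).1.congr_deriv (by
      rw [← hνγ]
      linear_combination (-ν * γ * (l / I₁) * sin (ψ t) ^ 2) * hFψ t)) (hψP t)
  refine ⟨P, l / I₁ * P, _, isTwistPeriod_of_add_two_pi hl hmono hP0 hcos hψP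
    hθP, fun t => by rw [hψP]; ring, rfl, hφP, ?_, ?_⟩
  · rw [← mul_assoc, hP, mul_div_cancel₀ _ hc.ne', hI]
    simp only [hF]
    rw [hK]; ring
  · rw [add_sub_cancel_left, hJ]
    simp only [hF]
    rw [hPi]; ring
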